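/- Let $\mathcal V$ be a variety of universal algebras, i.e. the category of all algebras satisfying a set of identities over a finitary signature, with all homomorphisms. Suppose that $\mathcal V$ is pointed (the terminal, one-point algebra $1$ is also initial) and congruence modular (the congruence lattice of each algebra in $\mathcal V$ is modular). For an algebra $X$ in $\mathcal V$, let the diagonal punctuation $DpX$ of $X$, with maps $\omega_X : X\times X\to DpX$ and $0:1\to DpX$, be the pushout in $\mathcal V$ of the diagonal $X\to X\times X$ along the terminal map $X\to 1$, and let $\eta_X=\omega_X\circ(0,1_X): X\to DpX$, so that $\eta_X(x)=\omega_X(0,x)$. Then: 1. For every $X$ in $\mathcal V$ the diagonal punctuation $DpX$ exists. It carries an internal group structure in $\mathcal V$ with unit $0$; this structure is the only internal group structure with unit $0$ on $DpX$, and it is abelian. 2. With this structure, $\eta_X$ is the universal homomorphism from $X$ to an internal abelian group of $\mathcal V$: for every internal abelian group $A$ in $\mathcal V$ and every homomorphism $f:X\to A$ there is exactly one homomorphism of internal groups $\phi:DpX\to A$ with $\phi\circ\eta_X=f$. Moreover $\eta_X$ is surjective. 3. The category $\mathrm{Ab}\,\mathcal V$ of internal abelian groups in $\mathcal V$ is a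 Birkhoff subcategory of $\mathcal V$ and a subvariety: the forgetful functor $\mathrm{Ab}\,\mathcal V\to\mathcal V$ is fully faithful and has a left adjoint, and its essential image is closed under subobjects and regular quotients and consists of exactly those algebras of $\mathcal V$ that satisfy a certain set of identities. -/

import Mathlib

open CategoryTheory Limits MonoidalCategory CartesianMonoidalCategory MonObj

universe u v

/-! ### Varieties of universal algebra

An algebraic signature is a first-order language without relation symbols, and an identity is a
pair of terms in countably many variables. -/

namespace UnivAlg

/-- The algebra `A` satisfies all the identities in `E`. -/
def Satisfies {L : FirstOrder.Language.{u, v}} (E : Set (L.Term ℕ × L.Term ℕ))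
    (A : Type u) [L.Structure A] : Prop :=
  ∀ e ∈ E, ∀ x : ℕ → A, e.1.realize x = e.2.realize x

/-- A congruence on an algebra: an equivalence relation compatible with all the operations. -/
structure Congruence (L : FirstOrder.Language.{u, v}) (A : Type u) [L.Structure A] where
  toSetoid : Setoid A
  compat : ∀ {n : ℕ} (f : L.Functions n) (x y : Fin n → A), (∀ i, toSetoid (x i) (y i)) →
    toSetoid (FirstOrder.Language.Structure.funMap f x) (FirstOrder.Language.Structure.funMap f y)

namespace Congruence

variable {L : FirstOrder.Language.{u, v}} {A : Type u} [L.Structure A]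

theorem toSetoid_injective :
    Function.Injective (toSetoid : Congruence L A → Setoid A) := by
  rintro ⟨r, hr⟩ ⟨s, hs⟩ h
  cases h
  rfl

/-- Congruences are ordered by inclusion. -/
instance : PartialOrder (Congruence L A) := PartialOrder.lift toSetoid toSetoid_injective

/-- Meets of congruences are intersections. -/
instance : InfSet (Congruence L A) where
  sInf S :=
    { toSetoid := sInf (toSetoid '' S)
      compat := by
        rintro n f x y h _ ⟨c, hc, rfl⟩
        exact c.compat f x y fun i => h i _ ⟨c, hc, rfl⟩ }

theorem isGLB_sInf (S : Set (Congruence L A)) : IsGLB S (sInf S) := by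
  constructor
  · intro c hc
    exact _root_.sInf_le (a := c.toSetoid) ⟨c, hc, rfl⟩
  · intro b hb
    refine _root_.le_sInf (a := b.toSetoid) ?_
    rintro _ ⟨c, hc, rfl⟩
    exact hb hc

/-- The lattice of congruences of an algebra. -/
instance : CompleteLattice (Congruence L A) := completeLatticeOfInf _ isGLB_sInf

end Congruence

/-- The variety of `L`-algebras defined by the set `E` of identities. (As usual in categorical
algebra, the empty algebra is allowed when `L` has no constant symbols.) -/
structure Variety (L : FirstOrder.Language.{u, v}) (E : Set (L.Term ℕ × L.Term ℕ)) where
  carrier : Type u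
  [str : L.Structure carrier]
  sat : Satisfies E carrier

attribute [instance] Variety.str

namespace Variety

variable {L : FirstOrder.Language.{u, v}} {E : Set (L.Term ℕ × L.Term ℕ)}

/-- A variety as a category, whose morphisms are all the homomorphisms of algebras. -/
instance : Category.{u} (Variety L E) where
  Hom A B := L.Hom A.carrier B.carrier
  id A := FirstOrder.Language.Hom.id L A.carrier
  comp f g := g.comp f

instance : ConcreteCategory (Variety L E) (fun A B => L.Hom A.carrier B.carrier) where
  hom f := f
  ofHom f := f

variable [L.IsAlgebraic]

/-- The one-point algebra. -/
def point (L : FirstOrder.Language.{u, v}) (E : Set (L.Term ℕ × L.Term ℕ)) [L.IsAlgebraic] :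
    Variety L E where
  carrier := PUnit.{u + 1}
  str := { funMap := fun _ _ => PUnit.unit, RelMap := fun r => isEmptyElim r }
  sat := fun _ _ _ => rfl

/-- The one-point algebra is terminal. -/
def pointIsTerminal : IsTerminal (point L E) :=
  IsTerminal.ofUniqueHom
    (fun _ =>
      { toFun := fun _ => PUnit.unit
        map_fun' := fun _ _ => rfl
        map_rel' := fun r => isEmptyElim r })
    (fun _ _ => FirstOrder.Language.Hom.ext fun _ => rfl)

/-- The operations of a product of two algebras are computed componentwise. -/
@[reducible] def prodStr (A B : Variety L E) : L.Structure (A.carrier × B.carrier) where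
  funMap f x := (FirstOrder.Language.Structure.funMap f fun i => (x i).1,
    FirstOrder.Language.Structure.funMap f fun i => (x i).2)
  RelMap r := isEmptyElim r

theorem realize_prod (A B : Variety L E) (t : L.Term ℕ) (x : ℕ → A.carrier × B.carrier) :
    @FirstOrder.Language.Term.realize L _ (prodStr A B) ℕ x t =
      (t.realize fun i => (x i).1, t.realize fun i => (x i).2) := by
  let _ := prodStr A B
  induction t with
  | var i => rfl
  | func f ts ih =>
    simp only [FirstOrder.Language.Term.realize_func, ih]
    rfl

/-- The product of two algebras. -/
def prod (A B : Variety L E) : Variety L E where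
  carrier := A.carrier × B.carrier
  str := prodStr A B
  sat e he x := by
    rw [realize_prod, realize_prod, A.sat e he, B.sat e he]

/-- The first projection. -/
def prodFst (A B : Variety L E) : prod A B ⟶ A where
  toFun p := p.1
  map_fun' _ _ := rfl
  map_rel' r := isEmptyElim r

/-- The second projection. -/
def prodSnd (A B : Variety L E) : prod A B ⟶ B where
  toFun p := p.2
  map_fun' _ _ := rfl
  map_rel' r := isEmptyElim r

/-- The homomorphism into a product with given components. -/
def prodLift {A B C : Variety L E} (f : C ⟶ A) (g : C ⟶ B) : C ⟶ prod A B where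
  toFun c := (f c, g c)
  map_fun' h x := Prod.ext
    (FirstOrder.Language.HomClass.map_fun (show L.Hom C.carrier A.carrier from f) h x)
    (FirstOrder.Language.HomClass.map_fun (show L.Hom C.carrier B.carrier from g) h x)
  map_rel' r := isEmptyElim r

/-- `prod A B` is the categorical product. -/
def prodIsLimit (A B : Variety L E) : IsLimit (BinaryFan.mk (prodFst A B) (prodSnd A B)) :=
  BinaryFan.isLimitMk (fun s => prodLift s.fst s.snd) (fun _ => rfl) (fun _ => rfl)
    (fun s _ h₁ h₂ => FirstOrder.Language.Hom.ext fun c =>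
      Prod.ext (congrArg (fun k : s.pt ⟶ A => k c) h₁) (congrArg (fun k : s.pt ⟶ B => k c) h₂))

/-- The finite products of a variety: `A ⊗ B` is `prod A B`, and `𝟙_` is the one-point algebra. -/
instance : CartesianMonoidalCategory (Variety L E) :=
  .ofChosenFiniteProducts ⟨_, pointIsTerminal⟩ fun A B => ⟨_, prodIsLimit A B⟩

instance : BraidedCategory (Variety L E) := .ofCartesianMonoidalCategory

end Variety

/-- A variety is congruence modular when the congruence lattice of each of its algebras is
modular. -/
def CongruenceModular (L : FirstOrder.Language.{u, v}) (E : Set (L.Term ℕ × L.Term ℕ)) : Prop :=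
  ∀ A : Variety L E, IsModularLattice (Congruence L A.carrier)

end UnivAlg

/-! ### Categorical notions -/

section Categorical

variable {C : Type*} [Category* C] [CartesianMonoidalCategory C]

/-- `(D, ω, z)` is a diagonal punctuation of `X`: the pushout of the diagonal `X ⟶ X ⊗ X` along
the terminal map `X ⟶ 𝟙_ C`. -/
def IsDiagonalPunctuation {X D : C} (ω : X ⊗ X ⟶ D) (z : 𝟙_ C ⟶ D) : Prop :=
  IsPushout (lift (𝟙 X) (𝟙 X)) (toUnit X) ω z

/-- The comparison `X ⟶ D`, `x ↦ ω (0, x)`, when the terminal object of the category is also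
initial; the first component is the zero morphism `X ⟶ 𝟙_ C ⟶ X`. -/
def diagonalComparison (h0 : IsInitial (𝟙_ C)) {X D : C} (ω : X ⊗ X ⟶ D) : X ⟶ D :=
  lift (toUnit X ≫ h0.to X) (𝟙 X) ≫ ω

end Categorical

/-- A fully faithful functor exhibits its source as a Birkhoff subcategory of its target: it has a
left adjoint, and its essential image is closed under subobjects and regular quotients. -/
structure IsBirkhoffSubcategory {D C : Type*} [Category* D] [Category* C] (F : D ⥤ C) : Prop where
  full : F.Full
  faithful : F.Faithful
  reflective : F.IsRightAdjoint
  of_mono : ∀ {X Y : C} (f : X ⟶ Y), Mono f → F.essImage Y → F.essImage X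
  of_regularEpi : ∀ {X Y : C} (f : X ⟶ Y), IsRegularEpi f → F.essImage X → F.essImage Y

/-!
Day's argument in the free algebra on four generators produces a chain of operations `m`, with
`m (x, y, y, x) = x`, from the first projection to the last. Together with the shifting lemma it
gives a difference term: `p (x, x, z) = z`, and `p (x, y, y) = x` modulo the commutator.

If `w : X × X → D` is constant on the diagonal, the difference term yields
`w (y, x) = p (w (0, x), w (0, y), w (0, 0)) = w (0, p (x, y, 0))`. For the punctuation
`ω : X × X → DpX`, this shows that `η` is surjective and that `(η x, η y) ↦ ω (y, x)` is a
well-defined homomorphism `s` with `s (a, a) = 0` and `s (a, 0) = a`. Any such `s` is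
`s (a, b) = p (a, b, 0)`, hence commutes with itself, and the Eckmann–Hilton argument turns it into
the subtraction of an internal abelian group.

The multiplication of every internal group is `p (a, 0, b)`, so it is determined by the algebra and
preserved by all homomorphisms. An algebra carries such a group precisely when it satisfies
the identities valid in all internal groups: among these are `p (x, y, y) = x` and the identities
saying that `p` is a homomorphism, whence `p (a, b, 0)` is again a subtraction.
-/

namespace UnivAlg

open FirstOrder.Language FirstOrder.Language.Structure

namespace Congruence

variable {L : FirstOrder.Language.{u, v}} {A : Type u} [L.Structure A]

theorem inf_apply {c d : Congruence L A} {x y : A} :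
    (c ⊓ d).toSetoid x y ↔ c.toSetoid x y ∧ d.toSetoid x y := by
  constructor
  · exact fun h => ⟨inf_le_left (a := c) (b := d) h, inf_le_right (a := c) (b := d) h⟩
  · rintro ⟨h₁, h₂⟩ _ ⟨e, rfl | rfl, rfl⟩
    exacts [h₁, h₂]

/-- An equivalence relation compatible with the operations in each argument separately, as a
congruence. -/
def ofUpdate (s : Setoid A)
    (h : ∀ {n : ℕ} (f : L.Functions n) (z : Fin n → A) (i : Fin n) (x y : A), s x y →
      s (funMap f (Function.update z i x)) (funMap f (Function.update z i y))) :
    Congruence L A where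
  toSetoid := s
  compat {n} f x y hxy := by
    have replace_on (t : Finset (Fin n)) : s (funMap f x) (funMap f (t.piecewise y x)) := by
      induction t using Finset.induction_on with
      | empty => rw [Finset.piecewise_empty]
      | insert i t hi ih =>
        have hx : Function.update (t.piecewise y x) i (x i) = t.piecewise y x :=
          Function.update_eq_self_iff.2 (t.piecewise_eq_of_notMem _ _ hi).symm
        have step := h f (t.piecewise y x) i (x i) (y i) (hxy i)
        rw [hx] at step
        rw [Finset.piecewise_insert]
        exact s.trans ih step
    simpa only [Finset.piecewise_univ] using replace_on Finset.univ

theorem compat_update (c : Congruence L A) {n : ℕ} (f : L.Functions n) (z : Fin n → A) (i : Fin n)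
    {x y : A} (h : c.toSetoid x y) :
    c.toSetoid (funMap f (Function.update z i x)) (funMap f (Function.update z i y)) := by
  refine c.compat f _ _ fun j => ?_
  rcases eq_or_ne j i with rfl | hj
  · simpa only [Function.update_self] using h
  · simp only [Function.update_of_ne hj]
    exact c.toSetoid.refl _

theorem toSetoid_sup (c d : Congruence L A) :
    (c ⊔ d).toSetoid = c.toSetoid ⊔ d.toSetoid := by
  have compat {n : ℕ} (f : L.Functions n) (z : Fin n → A) (i : Fin n) :
      c.toSetoid ⊔ d.toSetoid ≤
        (c.toSetoid ⊔ d.toSetoid).comap fun a => funMap f (Function.update z i a) :=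
    sup_le (fun {_ _} h => (le_sup_left : c.toSetoid ≤ _) (c.compat_update f z i h))
      (fun {_ _} h => (le_sup_right : d.toSetoid ≤ _) (d.compat_update f z i h))
  let e : Congruence L A :=
    ofUpdate (c.toSetoid ⊔ d.toSetoid) fun f z i _ _ h => compat f z i h
  have hc : c ≤ e := le_sup_left (a := c.toSetoid)
  have hd : d ≤ e := le_sup_right (a := c.toSetoid)
  exact le_antisymm (sup_le hc hd : c ⊔ d ≤ e)
    (sup_le (le_sup_left : c ≤ c ⊔ d) (le_sup_right : d ≤ c ⊔ d))

theorem sup_inf_apply_of_chain [IsModularLattice (Congruence L A)] {p q r : Congruence L A}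
    (hrq : r ≤ q) {x y z u : A} (hxy : p.toSetoid x y) (hyz : r.toSetoid y z)
    (hzu : p.toSetoid z u) (hxu : q.toSetoid x u) : (r ⊔ p ⊓ q).toSetoid x u := by
  have hp : p ≤ r ⊔ p := le_sup_right
  have hr : r ≤ r ⊔ p := le_sup_left
  rw [← sup_inf_assoc_of_le p hrq, inf_apply]
  exact ⟨(r ⊔ p).toSetoid.trans (hp hxy) ((r ⊔ p).toSetoid.trans (hr hyz) (hp hzu)), hxu⟩

theorem shifting [IsModularLattice (Congruence L A)] {p q r : Congruence L A} (h : p ⊓ q ≤ r)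
    {x y z w : A} (hxy : p.toSetoid x y) (hzw : p.toSetoid z w) (hxz : q.toSetoid x z)
    (hyw : q.toSetoid y w) (hr : r.toSetoid x z) : r.toSetoid y w :=
  (sup_le inf_le_right h : q ⊓ r ⊔ p ⊓ q ≤ r) (sup_inf_apply_of_chain inf_le_left
    (p.toSetoid.symm hxy) (inf_apply.2 ⟨hxz, hr⟩) hzw hyw)

instance prestructure [L.IsAlgebraic] (c : Congruence L A) : L.Prestructure c.toSetoid where
  toStructure := inferInstance
  fun_equiv := c.compat _
  rel_equiv {_ r} := isEmptyElim r

end Congruence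

namespace Variety

variable {L : FirstOrder.Language.{u, v}} {E : Set (L.Term ℕ × L.Term ℕ)}

/-! ### Homomorphisms and quotients -/

theorem map_funMap {A B : Variety L E} (f : A ⟶ B) {n : ℕ} (o : L.Functions n)
    (x : Fin n → A.carrier) : f (funMap o x) = funMap o (f ∘ x) :=
  FirstOrder.Language.HomClass.map_fun (show L.Hom A.carrier B.carrier from f) o x

theorem map_realize {A B : Variety L E} (f : A ⟶ B) {α : Type} (t : L.Term α)
    (x : α → A.carrier) : f (t.realize x) = t.realize (f ∘ x) :=
  (HomClass.realize_term (show L.Hom A.carrier B.carrier from f)).symm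

theorem satisfies_of_injective {A B : Variety L E} (f : A ⟶ B) (hf : Function.Injective f)
    {E' : Set (L.Term ℕ × L.Term ℕ)} (h : Satisfies E' B.carrier) : Satisfies E' A.carrier :=
  fun e he x => hf (by rw [map_realize, map_realize, h e he])

theorem satisfies_of_surjective {A B : Variety L E} (f : A ⟶ B) (hf : Function.Surjective f)
    {E' : Set (L.Term ℕ × L.Term ℕ)} (h : Satisfies E' A.carrier) : Satisfies E' B.carrier := by
  intro e he x
  obtain ⟨y, rfl⟩ := hf.comp_left x
  rw [← map_realize, ← map_realize, h e he]

/-- The kernel congruence of a homomorphism. -/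
def ker {A B : Variety L E} (f : A ⟶ B) : Congruence L A.carrier where
  toSetoid := Setoid.ker f
  compat o x y h := by
    rw [Setoid.ker_def, map_funMap, map_funMap]
    exact congrArg _ (funext h)

variable [L.IsAlgebraic]

/-- A map compatible with the operations, as a homomorphism. -/
def homMk {A B : Variety L E} (f : A.carrier → B.carrier)
    (h : ∀ {n : ℕ} (o : L.Functions n) (x : Fin n → A.carrier),
      f (funMap o x) = funMap o (f ∘ x)) : A ⟶ B :=
  (⟨f, h, fun r => isEmptyElim r⟩ : L.Hom A.carrier B.carrier)

/-- The quotient of an algebra by a congruence. -/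
def quot (A : Variety L E) (c : Congruence L A.carrier) : Variety L E where
  carrier := _root_.Quotient c.toSetoid
  sat e he x := by
    obtain ⟨y, rfl⟩ := (_root_.Quotient.mk_surjective (s := c.toSetoid)).comp_left x
    exact (Term.realize_quotient_mk' _ e.1 y).trans
      ((congrArg _ (A.sat e he y)).trans (Term.realize_quotient_mk' _ e.2 y).symm)

/-- The projection of an algebra onto its quotient by a congruence. -/
def quotMk (A : Variety L E) (c : Congruence L A.carrier) : A ⟶ quot A c :=
  homMk (fun a => ⟦a⟧) fun o x => (funMap_quotient_mk' c.toSetoid o x).symm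

theorem quotMk_surjective (A : Variety L E) (c : Congruence L A.carrier) :
    Function.Surjective (quotMk A c) :=
  _root_.Quotient.mk_surjective

theorem quotMk_eq_iff {A : Variety L E} {c : Congruence L A.carrier} {x y : A.carrier} :
    quotMk A c x = quotMk A c y ↔ c.toSetoid x y :=
  _root_.Quotient.eq

/-- The homomorphism induced on the codomain of a surjective homomorphism `q` by a homomorphism
that factors through `q` as a map. -/
noncomputable def descend {A B C : Variety L E} (q : A ⟶ B) (hq : Function.Surjective q)
    (f : A ⟶ C) (h : Function.FactorsThrough f q) : B ⟶ C :=
  homMk (f ∘ Function.surjInv hq) fun o x => by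
    have hx : q ∘ Function.surjInv hq ∘ x = x := funext fun i => Function.surjInv_eq hq (x i)
    have : q (Function.surjInv hq (funMap o x)) = q (funMap o (Function.surjInv hq ∘ x)) :=
      (Function.surjInv_eq hq _).trans (by rw [map_funMap, hx])
    exact (h this).trans (map_funMap f o _)

theorem descend_apply {A B C : Variety L E} (q : A ⟶ B) (hq : Function.Surjective q)
    (f : A ⟶ C) (h : Function.FactorsThrough f q) (a : A.carrier) :
    descend q hq f h (q a) = f a :=
  h (Function.surjInv_eq hq (q a))

theorem surjective_of_isRegularEpi {A B : Variety L E} (f : A ⟶ B) [hf : IsRegularEpi f] :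
    Function.Surjective f := by
  obtain ⟨r⟩ := hf.regularEpi
  let π := quotMk A (ker f)
  have hπ : Function.Surjective π := quotMk_surjective A (ker f)
  obtain ⟨l, hl⟩ := r.desc' π <| ConcreteCategory.hom_ext _ _ fun x =>
    quotMk_eq_iff.2 (ConcreteCategory.congr_hom r.w x)
  let i : quot A (ker f) ⟶ B := descend π hπ f fun _ _ h => quotMk_eq_iff.1 h
  have hi (a : A.carrier) : i (π a) = f a := descend_apply ..
  have hli : l ≫ i = 𝟙 B := by
    rw [← cancel_epi f, ← Category.assoc, hl, Category.comp_id]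
    exact ConcreteCategory.hom_ext _ _ hi
  intro b
  obtain ⟨a, ha⟩ := hπ (l b)
  refine ⟨a, ?_⟩
  rw [← hi, ha]
  exact ConcreteCategory.congr_hom hli b

/-! ### Free algebras -/

variable (L E) in
/-- Two terms are identified when they agree in all the algebras of the variety. -/
def termSetoid (α : Type) : Setoid (L.Term α) where
  r s t := ∀ (A : Variety L E) (x : α → A.carrier), s.realize x = t.realize x
  iseqv := ⟨fun _ _ _ => rfl, fun h A x => (h A x).symm, fun h h' A x => (h A x).trans (h' A x)⟩

instance termPrestructure (α : Type) : L.Prestructure (termSetoid L E α) where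
  toStructure := { funMap := Term.func, RelMap := fun r => isEmptyElim r }
  fun_equiv _ _ h A x := congrArg (funMap _) (funext fun i => h i A x)
  rel_equiv {_ r} := isEmptyElim r

theorem realize_term_eq_subst {α β : Type} (t : L.Term β) (x : β → L.Term α) :
    @Term.realize L _ (termPrestructure (E := E) α).toStructure β x t = t.subst x := by
  induction t with
  | var i => rfl
  | func f ts ih => exact congrArg (Term.func f) (funext ih)

variable (L E) in
/-- The free algebra on `α`: its elements are the operations of arity `α` of the variety. -/
def free (α : Type) : Variety L E where
  carrier := _root_.Quotient (termSetoid L E α)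
  sat e he x := by
    obtain ⟨y, rfl⟩ := (_root_.Quotient.mk_surjective (s := termSetoid L E α)).comp_left x
    refine (Term.realize_quotient_mk' _ e.1 y).trans
      (Eq.trans ?_ (Term.realize_quotient_mk' _ e.2 y).symm)
    rw [realize_term_eq_subst, realize_term_eq_subst]
    refine _root_.Quotient.sound fun A x => ?_
    rw [Term.realize_subst, Term.realize_subst, A.sat e he]

variable {α β : Type}

variable (E) in
/-- The element of the free algebra represented by a term. -/
def freeMk (t : L.Term α) : (free L E α).carrier := Quotient.mk (termSetoid L E α) t

theorem freeMk_surjective : Function.Surjective (freeMk (L := L) E (α := α)) :=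
  _root_.Quotient.mk_surjective

/-- The generators of a free algebra; as operations, they are the projections. -/
def gen (i : α) : (free L E α).carrier := freeMk E (.var i)

/-- An element of a free algebra, acting as an operation on an algebra of the variety. -/
def op (m : (free L E α).carrier) {A : Variety L E} (x : α → A.carrier) : A.carrier :=
  _root_.Quotient.lift (fun t : L.Term α => t.realize x)
    (fun _ _ h => (h : termSetoid L E α _ _) A x) m

theorem op_gen (i : α) {A : Variety L E} (x : α → A.carrier) :
    op (gen i : (free L E α).carrier) x = x i := rfl

theorem op_funMap {n : ℕ} (o : L.Functions n) (m : Fin n → (free L E α).carrier)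
    {A : Variety L E} (x : α → A.carrier) : op (funMap o m) x = funMap o fun i => op (m i) x := by
  obtain ⟨t, rfl⟩ := freeMk_surjective.comp_left m
  exact congrArg (fun m : (free L E α).carrier => op m x)
    (funMap_quotient_mk' (termSetoid L E α) o t)

theorem map_op {A B : Variety L E} (f : A ⟶ B) (m : (free L E α).carrier) (x : α → A.carrier) :
    f (op m x) = op m (f ∘ x) := by
  obtain ⟨t, rfl⟩ := freeMk_surjective m
  exact map_realize f t x

/-- The homomorphism from a free algebra with given values at the generators. -/
def freeLift {A : Variety L E} (x : α → A.carrier) : free L E α ⟶ A :=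
  homMk (fun m => op m x) fun o m => op_funMap o m x

theorem freeLift_comp {A B : Variety L E} (x : α → A.carrier) (f : A ⟶ B) :
    freeLift x ≫ f = freeLift (f ∘ x) :=
  ConcreteCategory.hom_ext _ _ fun m => map_op f m x

theorem injective_of_mono {A B : Variety L E} (f : A ⟶ B) [Mono f] : Function.Injective f := by
  intro a b h
  have key : freeLift (fun _ : Unit => a) ≫ f = freeLift (fun _ => b) ≫ f := by
    rw [freeLift_comp, freeLift_comp]
    exact congrArg freeLift (funext fun _ => h)
  exact ConcreteCategory.congr_hom ((cancel_mono f).1 key) (gen ())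

/-- The congruence on a free algebra which relates two operations when they agree after the
identification of variables `σ`. -/
def identify (σ : α → β) : Congruence L (free L E α).carrier where
  toSetoid :=
    { r := fun m m' => ∀ (A : Variety L E) (x : β → A.carrier), op m (x ∘ σ) = op m' (x ∘ σ)
      iseqv := ⟨fun _ _ _ => rfl, fun h A x => (h A x).symm,
        fun h h' A x => (h A x).trans (h' A x)⟩ }
  compat f m m' h A x := by
    rw [op_funMap, op_funMap]
    exact congrArg (funMap f) (funext fun i => h i A x)

theorem identify_gen {σ : α → β} {i j : α} (h : σ i = σ j) :
    (identify (L := L) (E := E) σ).toSetoid (gen i) (gen j) :=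
  fun _ x => congrArg x h

theorem identify_le_comp {δ : Type} (σ : α → β) (τ : β → δ) :
    identify (L := L) (E := E) σ ≤ identify (τ ∘ σ) :=
  fun {_ _} h A x => h A (x ∘ τ)

theorem op_eq_of_identify₄ {σ : Fin 4 → β} {m m' : (free L E (Fin 4)).carrier}
    (h : (identify σ).toSetoid m m') {A : Variety L E} (x : β → A.carrier) :
    op m ![x (σ 0), x (σ 1), x (σ 2), x (σ 3)] = op m' ![x (σ 0), x (σ 1), x (σ 2), x (σ 3)] := by
  have hx : ![x (σ 0), x (σ 1), x (σ 2), x (σ 3)] = x ∘ σ := FinVec.etaExpand_eq (x ∘ σ)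
  rw [hx]
  exact h A x

theorem map_op₃ {A B : Variety L E} (f : A ⟶ B) (p : (free L E (Fin 3)).carrier)
    (x y z : A.carrier) : f (op p ![x, y, z]) = op p ![f x, f y, f z] :=
  (map_op f p _).trans (congrArg (op p) (FinVec.map_eq f ![x, y, z]).symm)

theorem op_op₄ (m : (free L E (Fin 4)).carrier) (p q r s : (free L E α).carrier)
    {A : Variety L E} (x : α → A.carrier) :
    op (op m ![p, q, r, s]) x = op m ![op p x, op q x, op r x, op s x] :=
  (map_op (freeLift x) m _).trans
    (congrArg (op m) (FinVec.map_eq (freeLift x) ![p, q, r, s]).symm)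

/-! ### Elements of products -/

/-- The pair of two elements, as an element of the categorical product. -/
def pair {A B : Variety L E} (a : A.carrier) (b : B.carrier) : (A ⊗ B).carrier := (a, b)

theorem pair_op {A B : Variety L E} (m : (free L E α).carrier) (x : α → A.carrier)
    (y : α → B.carrier) : pair (op m x) (op m y) = op m fun i => pair (x i) (y i) :=
  Prod.ext (map_op (fst A B) m fun i => pair (x i) (y i)).symm
    (map_op (snd A B) m fun i => pair (x i) (y i)).symm

theorem map_pair_op₃ {A B C : Variety L E} (f : A ⊗ B ⟶ C) (p : (free L E (Fin 3)).carrier)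
    (x y z : A.carrier) (x' y' z' : B.carrier) :
    f (pair (op p ![x, y, z]) (op p ![x', y', z'])) =
      op p ![f (pair x x'), f (pair y y'), f (pair z z')] := by
  rw [pair_op, map_op]
  exact congrArg (op p) (FinVec.etaExpand_eq _).symm

theorem map_pair_op₄ {A B C : Variety L E} (f : A ⊗ B ⟶ C) (m : (free L E (Fin 4)).carrier)
    (x y z u : A.carrier) (x' y' z' u' : B.carrier) :
    f (pair (op m ![x, y, z, u]) (op m ![x', y', z', u'])) =
      op m ![f (pair x x'), f (pair y y'), f (pair z z'), f (pair u u')] := by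
  rw [pair_op, map_op]
  exact congrArg (op m) (FinVec.etaExpand_eq _).symm

/-! ### The shifting lemma for products -/

theorem shift_fst (hm : CongruenceModular L E) {A B C : Variety L E} (f : A ⊗ B ⟶ C)
    {a : A.carrier} {b b' : B.carrier} (h : f (pair a b) = f (pair a b')) (a' : A.carrier) :
    f (pair a' b) = f (pair a' b') := by
  have := hm (A ⊗ B)
  have inf_le : ker (snd A B) ⊓ ker (fst A B) ≤ ker f := fun {x y} hxy =>
    have ⟨h₁, h₂⟩ := Congruence.inf_apply.1 hxy
    congrArg f (Prod.ext h₂ h₁ : x = y)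
  exact Congruence.shifting inf_le (x := pair a b) (y := pair a' b) (z := pair a b')
    (w := pair a' b') rfl rfl rfl rfl h

/-! ### The difference term -/

/-- Two elements of `X` are related when no homomorphism on `X ⊗ X` which is constant on the
diagonal tells them apart in its second argument: in a congruence modular variety this is
congruence modulo the commutator `[⊤, ⊤]` of the largest congruence with itself. -/
def CommutatorRel {X : Variety L E} (a b : X.carrier) : Prop :=
  ∀ ⦃D : Variety L E⦄ (w : X ⊗ X ⟶ D), (∀ x y, w (pair x x) = w (pair y y)) →
    ∀ c, w (pair c a) = w (pair c b)

/-- The equation satisfied by each of the Day terms which witness congruence modularity. -/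
def IsDayTerm (m : (free L E (Fin 4)).carrier) : Prop :=
  ∀ (A : Variety L E) (x y : A.carrier), op m ![x, y, y, x] = x

theorem IsDayTerm.congr {m m' : (free L E (Fin 4)).carrier} (hm : IsDayTerm m)
    (h : (identify ![(0 : Fin 2), 1, 1, 0]).toSetoid m m') : IsDayTerm m' :=
  fun A x y => (op_eq_of_identify₄ h ![x, y]).symm.trans (hm A x y)

theorem CommutatorRel.change_parameter (hm : CongruenceModular L E)
    {m : (free L E (Fin 4)).carrier} (hmid : IsDayTerm m) {X : Variety L E}
    {x y t e : X.carrier} (h : CommutatorRel e (op m ![y, t, x, x])) (t' : X.carrier) :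
    CommutatorRel (op m ![e, t', t, e]) (op m ![y, t', x, x]) := by
  intro D w hw c
  set V := op m ![y, t, x, x]
  have w_eq (a : X.carrier) : w (pair V e) = w (pair a a) := (h w hw V).trans (hw V a)
  refine shift_fst hm w (a := V) ?_ c
  calc w (pair V (op m ![e, t', t, e]))
      = w (pair (op m ![V, t, t, V]) (op m ![e, t', t, e])) := by rw [hmid]
    _ = op m ![w (pair V e), w (pair t t'), w (pair t t), w (pair V e)] := map_pair_op₄ ..
    _ = op m ![w (pair y y), w (pair t t'), w (pair x x), w (pair x x)] := by
      rw [hw t x, ← w_eq x, ← w_eq y]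
    _ = w (pair V (op m ![y, t', x, x])) := (map_pair_op₄ ..).symm

/-- A difference term: a ternary term with `p (x, x, z) = z` which satisfies the other Mal'tsev
identity `p (x, y, y) = x` modulo the commutator. -/
structure IsDifferenceTerm (p : (free L E (Fin 3)).carrier) : Prop where
  left : ∀ (A : Variety L E) (x z : A.carrier), op p ![x, x, z] = z
  right : ∀ (A : Variety L E) (x y : A.carrier), CommutatorRel (op p ![x, y, y]) x

/-- A ternary term with `p (x, x, z) = z` such that, modulo the commutator, `p (x, y, y)` is
`m (y, t, x, x)`, where `t` is the variable `x` for `i = 0` and `y` for `i = 1`. Along a chain of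
Day terms `m` from the first projection to the last, this leads from the third projection to a
difference term. -/
structure IsApproximant (m : (free L E (Fin 4)).carrier) (i : Fin 2)
    (p : (free L E (Fin 3)).carrier) : Prop where
  left : ∀ (A : Variety L E) (x z : A.carrier), op p ![x, x, z] = z
  right : ∀ (A : Variety L E) (x y : A.carrier),
    CommutatorRel (op p ![x, y, y]) (op m ![y, ![x, y] i, x, x])

theorem IsApproximant.change_parameter (hm : CongruenceModular L E)
    {m : (free L E (Fin 4)).carrier} (hmid : IsDayTerm m) {i : Fin 2}
    {p : (free L E (Fin 3)).carrier} (hp : IsApproximant m i p) (j : Fin 2) :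
    IsApproximant m j (op m ![p, gen j.castSucc, gen i.castSucc, p]) where
  left A x z := by
    have variable_eq (k : Fin 2) : ![x, x, z] k.castSucc = x := by fin_cases k <;> rfl
    rw [op_op₄, op_gen, op_gen, hp.left, variable_eq, variable_eq, hmid]
  right A x y := by
    have variable_eq (k : Fin 2) : ![x, y, y] k.castSucc = ![x, y] k := by fin_cases k <;> rfl
    rw [op_op₄, op_gen, op_gen, variable_eq, variable_eq]
    exact (hp.right A x y).change_parameter hm hmid _

theorem IsApproximant.congr {m m' : (free L E (Fin 4)).carrier} {i : Fin 2}
    {p : (free L E (Fin 3)).carrier} (hp : IsApproximant m i p)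
    (h : ∀ (A : Variety L E) (x y : A.carrier),
      op m ![y, ![x, y] i, x, x] = op m' ![y, ![x, y] i, x, x]) : IsApproximant m' i p :=
  ⟨hp.left, fun A x y => h A x y ▸ hp.right A x y⟩

/-- The invariant of the induction along Day's chain. -/
def HasApproximants (m : (free L E (Fin 4)).carrier) : Prop :=
  IsDayTerm m ∧ ∀ i, ∃ p, IsApproximant m i p

theorem hasApproximants_gen_zero : HasApproximants (gen 0 : (free L E (Fin 4)).carrier) :=
  ⟨fun _ _ _ => rfl, fun _ => ⟨gen 2, fun _ _ _ => rfl, fun _ _ _ _ _ _ _ => rfl⟩⟩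

theorem HasApproximants.congr (hm : CongruenceModular L E) {m m' : (free L E (Fin 4)).carrier}
    (h : HasApproximants m) (hq : (identify ![(0 : Fin 2), 1, 1, 0]).toSetoid m m') (i : Fin 2)
    (hi : ∀ (A : Variety L E) (x y : A.carrier),
      op m ![y, ![x, y] i, x, x] = op m' ![y, ![x, y] i, x, x]) : HasApproximants m' := by
  obtain ⟨p, hp⟩ := h.2 i
  have hmid := h.1.congr hq
  exact ⟨hmid, fun j => ⟨_, (hp.congr hi).change_parameter hm hmid j⟩⟩

theorem toSetoid_le_ker_hasApproximants (hm : CongruenceModular L E)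
    (c : Congruence L (free L E (Fin 4)).carrier) (hq : c ≤ identify ![(0 : Fin 2), 1, 1, 0])
    (i : Fin 2) (hi : ∀ ⦃m m'⦄, c.toSetoid m m' → ∀ (A : Variety L E) (x y : A.carrier),
      op m ![y, ![x, y] i, x, x] = op m' ![y, ![x, y] i, x, x]) :
    c.toSetoid ≤ Setoid.ker HasApproximants := fun {_ _} h =>
  have h' := c.toSetoid.symm h
  propext ⟨fun H => H.congr hm (hq h) i (hi h), fun H => H.congr hm (hq h') i (hi h')⟩

theorem exists_isDifferenceTerm (hm : CongruenceModular L E) :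
    ∃ p : (free L E (Fin 3)).carrier, IsDifferenceTerm p := by
  have := hm (free L E (Fin 4))
  let r := identify (L := L) (E := E) ![(0 : Fin 3), 1, 1, 2]
  let s := identify (L := L) (E := E) ![(0 : Fin 2), 0, 1, 1]
  let q := identify (L := L) (E := E) ![(0 : Fin 2), 1, 1, 0]
  have hrq : r ≤ q := by
    have hq : q = identify (![(0 : Fin 2), 1, 0] ∘ ![(0 : Fin 3), 1, 1, 2]) :=
      congrArg identify (FinVec.map_eq ![(0 : Fin 2), 1, 0] ![(0 : Fin 3), 1, 1, 2])
    exact hq ▸ identify_le_comp _ _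
  have r_le : r.toSetoid ≤ Setoid.ker HasApproximants :=
    toSetoid_le_ker_hasApproximants hm r hrq 0 fun _ _ h _ x y => op_eq_of_identify₄ h ![y, x, x]
  have sq_le : (s ⊓ q).toSetoid ≤ Setoid.ker HasApproximants :=
    toSetoid_le_ker_hasApproximants hm (s ⊓ q) inf_le_right 1 fun _ _ h _ x y =>
      op_eq_of_identify₄ (Congruence.inf_apply.1 h).1 ![y, x]
  have day_chain : (r ⊔ s ⊓ q).toSetoid (gen 0) (gen 3) :=
    Congruence.sup_inf_apply_of_chain hrq (y := gen 1) (z := gen 2) (identify_gen rfl)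
      (identify_gen rfl) (identify_gen rfl) (identify_gen rfl)
  rw [Congruence.toSetoid_sup] at day_chain
  have invariant : HasApproximants (gen 0) = HasApproximants (gen 3) := sup_le r_le sq_le day_chain
  obtain ⟨p, hp⟩ := (invariant ▸ hasApproximants_gen_zero).2 0
  exact ⟨p, hp.left, hp.right⟩

namespace IsDifferenceTerm

variable {p : (free L E (Fin 3)).carrier}

theorem map_pair_eq_op (hp : IsDifferenceTerm p) {X D : Variety L E} (w : X ⊗ X ⟶ D)
    (hw : ∀ x y, w (pair x x) = w (pair y y)) (o x y : X.carrier) :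
    w (pair y x) = op p ![w (pair o x), w (pair o y), w (pair o o)] := by
  calc w (pair y x) = w (pair y (op p ![x, y, y])) := (hp.right X x y w hw y).symm
    _ = w (pair (op p ![o, o, y]) (op p ![x, y, y])) := by rw [hp.left]
    _ = op p ![w (pair o x), w (pair o y), w (pair y y)] := map_pair_op₃ ..
    _ = _ := by rw [hw y o]

theorem map_pair_eq (hp : IsDifferenceTerm p) {X D : Variety L E} (w : X ⊗ X ⟶ D)
    (hw : ∀ x y, w (pair x x) = w (pair y y)) (o x y : X.carrier) :
    w (pair y x) = w (pair o (op p ![x, y, o])) := by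
  rw [hp.map_pair_eq_op w hw o x y, ← map_pair_op₃, hp.left]

end IsDifferenceTerm

/-! ### Subtractions -/

/-- The zero element of an algebra of a pointed variety. -/
def zero (h0 : IsInitial (𝟙_ (Variety L E))) (A : Variety L E) : A.carrier :=
  h0.to A PUnit.unit

theorem hom_unit_apply (h0 : IsInitial (𝟙_ (Variety L E))) {A : Variety L E}
    (z : 𝟙_ (Variety L E) ⟶ A) (e : (𝟙_ (Variety L E) : Variety L E).carrier) :
    z e = zero h0 A :=
  ConcreteCategory.congr_hom (h0.hom_ext z (h0.to A)) PUnit.unit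

theorem map_zero (h0 : IsInitial (𝟙_ (Variety L E))) {A B : Variety L E} (f : A ⟶ B) :
    f (zero h0 A) = zero h0 B :=
  hom_unit_apply h0 (h0.to A ≫ f) PUnit.unit

theorem pair_zero (h0 : IsInitial (𝟙_ (Variety L E))) (A B : Variety L E) :
    pair (zero h0 A) (zero h0 B) = zero h0 (A ⊗ B) :=
  Prod.ext (map_zero h0 (fst A B)).symm (map_zero h0 (snd A B)).symm

/-- A homomorphism `s : D ⊗ D ⟶ D` such that `s (a, a) = 0` and `s (a, 0) = a`. -/
structure IsSubtraction (h0 : IsInitial (𝟙_ (Variety L E))) {D : Variety L E} (s : D ⊗ D ⟶ D) :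
    Prop where
  self (a : D.carrier) : s (pair a a) = zero h0 D
  right_zero (a : D.carrier) : s (pair a (zero h0 D)) = a

variable {p : (free L E (Fin 3)).carrier} {h0 : IsInitial (𝟙_ (Variety L E))}

namespace IsSubtraction

variable {D : Variety L E} {s : D ⊗ D ⟶ D}

theorem op_right (hs : IsSubtraction h0 s) (hp : IsDifferenceTerm p) (a b : D.carrier) :
    op p ![a, b, b] = a := by
  let w : D ⊗ D ⟶ D := lift (snd D D) (fst D D) ≫ s
  have hw (x y : D.carrier) : w (pair x x) = w (pair y y) := (hs.self x).trans (hs.self y).symm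
  have key : s (pair (op p ![a, b, b]) (zero h0 D)) = s (pair a (zero h0 D)) :=
    hp.right D a b w hw (zero h0 D)
  rwa [hs.right_zero, hs.right_zero] at key

theorem eq_op (hs : IsSubtraction h0 s) (hp : IsDifferenceTerm p) (a b : D.carrier) :
    s (pair a b) = op p ![a, b, zero h0 D] := by
  calc s (pair a b) = s (pair (op p ![a, b, b]) (op p ![zero h0 D, zero h0 D, b])) := by
        rw [hs.op_right hp, hp.left]
    _ = op p ![s (pair a (zero h0 D)), s (pair b (zero h0 D)), s (pair b b)] := map_pair_op₃ ..
    _ = op p ![a, b, zero h0 D] := by rw [hs.right_zero, hs.right_zero, hs.self]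

theorem medial (hs : IsSubtraction h0 s) (hp : IsDifferenceTerm p) (a b c d : D.carrier) :
    s (pair (s (pair a b)) (s (pair c d))) = s (pair (s (pair a c)) (s (pair b d))) := by
  rw [hs.eq_op hp a b, hs.eq_op hp c d, map_pair_op₃, hs.right_zero, ← hs.eq_op hp]

/-- The inversion defined by a subtraction. -/
def neg (_ : IsSubtraction h0 s) : D ⟶ D := lift (toUnit D ≫ h0.to D) (𝟙 D) ≫ s

theorem neg_apply (hs : IsSubtraction h0 s) (a : D.carrier) :
    hs.neg a = s (pair (zero h0 D) a) := rfl

theorem neg_neg (hs : IsSubtraction h0 s) (hp : IsDifferenceTerm p) (a : D.carrier) :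
    hs.neg (hs.neg a) = a := by
  rw [neg_apply, neg_apply, ← hs.self a, hs.medial hp, hs.self a, hs.right_zero, hs.right_zero]

theorem neg_sub (hs : IsSubtraction h0 s) (hp : IsDifferenceTerm p) (a b : D.carrier) :
    hs.neg (s (pair a b)) = s (pair (hs.neg a) (hs.neg b)) := by
  rw [neg_apply, ← hs.self (zero h0 D), hs.medial hp]
  rfl

/-- The addition defined by a subtraction. -/
def add (hs : IsSubtraction h0 s) : D ⊗ D ⟶ D := lift (fst D D) (snd D D ≫ hs.neg) ≫ s

theorem add_apply (hs : IsSubtraction h0 s) (a b : D.carrier) :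
    hs.add (pair a b) = s (pair a (hs.neg b)) := rfl

theorem op_eq (hs : IsSubtraction h0 s) (hp : IsDifferenceTerm p) (a b c : D.carrier) :
    op p ![a, b, c] = hs.add (pair (s (pair a b)) c) := by
  calc op p ![a, b, c]
      = op p ![s (pair a (zero h0 D)), s (pair b (zero h0 D)),
          s (pair (zero h0 D) (hs.neg c))] := by
        rw [hs.right_zero, hs.right_zero, ← hs.neg_apply, hs.neg_neg hp]
    _ = s (pair (op p ![a, b, zero h0 D]) (op p ![zero h0 D, zero h0 D, hs.neg c])) :=
        (map_pair_op₃ ..).symm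
    _ = hs.add (pair (s (pair a b)) c) := by rw [hp.left, ← hs.eq_op hp, add_apply]

theorem op_funMap_eq (hs : IsSubtraction h0 s) (hp : IsDifferenceTerm p) {n : ℕ}
    (o : L.Functions n) (x y z : Fin n → D.carrier) :
    op p ![funMap o x, funMap o y, funMap o z] = funMap o fun i => op p ![x i, y i, z i] := by
  let k : (D ⊗ D) ⊗ D ⟶ D := lift (fst (D ⊗ D) D ≫ s) (snd (D ⊗ D) D) ≫ hs.add
  have hk (a b c : D.carrier) : k (pair (pair a b) c) = op p ![a, b, c] := (hs.op_eq hp a b c).symm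
  simp only [← hk]
  exact map_funMap k o fun i => pair (pair (x i) (y i)) (z i)

theorem isUnital_add (hs : IsSubtraction h0 s) (hp : IsDifferenceTerm p) :
    EckmannHilton.IsUnital (fun a b : D.carrier => hs.add (pair a b)) (zero h0 D) where
  left_id := hs.neg_neg hp
  right_id a := by rw [add_apply, map_zero h0, hs.right_zero]

theorem add_neg (hs : IsSubtraction h0 s) (hp : IsDifferenceTerm p) (a : D.carrier) :
    hs.add (pair a (hs.neg a)) = zero h0 D := by
  rw [add_apply, hs.neg_neg hp, hs.self]

theorem add_add_add_comm (hs : IsSubtraction h0 s) (hp : IsDifferenceTerm p)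
    (a b c d : D.carrier) :
    hs.add (pair (hs.add (pair a b)) (hs.add (pair c d))) =
      hs.add (pair (hs.add (pair a c)) (hs.add (pair b d))) := by
  simp only [add_apply, hs.neg_sub hp]
  exact hs.medial hp ..

theorem add_comm (hs : IsSubtraction h0 s) (hp : IsDifferenceTerm p) (a b : D.carrier) :
    hs.add (pair a b) = hs.add (pair b a) :=
  (EckmannHilton.mul_comm (hs.isUnital_add hp) (hs.isUnital_add hp) (hs.add_add_add_comm hp)).comm
    a b

theorem add_assoc (hs : IsSubtraction h0 s) (hp : IsDifferenceTerm p) (a b c : D.carrier) :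
    hs.add (pair (hs.add (pair a b)) c) = hs.add (pair a (hs.add (pair b c))) :=
  (EckmannHilton.mul_assoc (hs.isUnital_add hp) (hs.isUnital_add hp)
    (hs.add_add_add_comm hp)).assoc a b c

/-- The internal group defined by a subtraction. -/
@[reducible] def grpObj (hs : IsSubtraction h0 s) (hp : IsDifferenceTerm p) : GrpObj D where
  one := h0.to D
  mul := hs.add
  one_mul := ConcreteCategory.hom_ext _ _ fun x => (hs.isUnital_add hp).left_id x.2
  mul_one := ConcreteCategory.hom_ext _ _ fun x => (hs.isUnital_add hp).right_id x.1
  mul_assoc := ConcreteCategory.hom_ext _ _ fun x => hs.add_assoc hp x.1.1 x.1.2 x.2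
  inv := hs.neg
  left_inv := ConcreteCategory.hom_ext _ _ fun a => (hs.add_comm hp _ _).trans (hs.add_neg hp a)
  right_inv := ConcreteCategory.hom_ext _ _ (hs.add_neg hp)

theorem isCommMonObj (hs : IsSubtraction h0 s) (hp : IsDifferenceTerm p) :
    @IsCommMonObj _ _ _ _ D (hs.grpObj hp).toMonObj :=
  let _ := hs.grpObj hp
  ⟨ConcreteCategory.hom_ext _ _ fun x => hs.add_comm hp x.2 x.1⟩

end IsSubtraction

/-! ### Internal groups -/

section GrpObj

variable (h0) (D : Variety L E) [GrpObj D]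

theorem grp_zero_mul (a : D.carrier) : μ[D] (pair (zero h0 D) a) = a := by
  have hη : η[D] = h0.to D := h0.hom_ext _ _
  have key : (η[D] ▷ D ≫ μ[D]) (pair PUnit.unit a) = a :=
    ConcreteCategory.congr_hom (MonObj.one_mul D) (pair PUnit.unit a)
  rwa [hη] at key

theorem grp_mul_zero (a : D.carrier) : μ[D] (pair a (zero h0 D)) = a := by
  have hη : η[D] = h0.to D := h0.hom_ext _ _
  have key : (D ◁ η[D] ≫ μ[D]) (pair a PUnit.unit) = a :=
    ConcreteCategory.congr_hom (MonObj.mul_one D) (pair a PUnit.unit)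
  rwa [hη] at key

/-- The subtraction of an internal group. -/
def grpSub : D ⊗ D ⟶ D := lift (fst D D) (snd D D ≫ GrpObj.inv) ≫ μ[D]

theorem isSubtraction_grpSub : IsSubtraction h0 (grpSub D) where
  self a := (ConcreteCategory.congr_hom (GrpObj.right_inv D) a).trans (hom_unit_apply h0 η[D] _)
  right_zero a := by
    change μ[D] (pair a ((GrpObj.inv : D ⟶ D) (zero h0 D))) = a
    rw [map_zero h0, grp_mul_zero]

variable {D}

theorem grp_mul_eq_op (hp : IsDifferenceTerm p) (a b : D.carrier) :
    μ[D] (pair a b) = op p ![a, zero h0 D, b] := by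
  calc μ[D] (pair a b)
      = μ[D] (pair (op p ![a, zero h0 D, zero h0 D]) (op p ![zero h0 D, zero h0 D, b])) := by
        rw [(isSubtraction_grpSub h0 D).op_right hp, hp.left]
    _ = op p ![μ[D] (pair a (zero h0 D)), μ[D] (pair (zero h0 D) (zero h0 D)),
          μ[D] (pair (zero h0 D) b)] := map_pair_op₃ ..
    _ = op p ![a, zero h0 D, b] := by rw [grp_mul_zero, grp_mul_zero, grp_zero_mul]

include h0 in
theorem isMonHom (hp : IsDifferenceTerm p) {A : Variety L E} [GrpObj A] (f : D ⟶ A) :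
    IsMonHom f where
  one_hom := h0.hom_ext _ _
  mul_hom := ConcreteCategory.hom_ext _ _ fun x => by
    change f (μ[D] (pair x.1 x.2)) = μ[A] (pair (f x.1) (f x.2))
    rw [grp_mul_eq_op h0 hp, grp_mul_eq_op h0 hp, map_op₃, map_zero h0]

end GrpObj

theorem grpObj_unique (h0 : IsInitial (𝟙_ (Variety L E))) (hp : IsDifferenceTerm p)
    {D : Variety L E} (G G' : GrpObj D) : G = G' := by
  have hmul := (@isMonHom _ _ _ p h0 D G hp D G' (𝟙 D)).mul_hom
  exact GrpObj.ext _ _ (MonObj.ext _ _ (by simpa using hmul))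

/-- A homomorphism between internal abelian groups, as a homomorphism of groups. -/
def commGrpHom (h0 : IsInitial (𝟙_ (Variety L E))) (hp : IsDifferenceTerm p)
    {A B : CommGrp (Variety L E)} (f : A.X ⟶ B.X) : A ⟶ B :=
  have := isMonHom h0 hp f
  InducedCategory.homMk (Grp.homMk f)

/-! ### The diagonal punctuation -/

/-- The least congruence collapsing the diagonal. -/
def diagCongruence (X : Variety L E) : Congruence L (X ⊗ X).carrier :=
  sInf {c | ∀ x y : X.carrier, c.toSetoid (pair x x) (pair y y)}

theorem diagCongruence_diag (X : Variety L E) (x y : X.carrier) :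
    (diagCongruence X).toSetoid (pair x x) (pair y y) := by
  rintro _ ⟨c, hc, rfl⟩
  exact hc x y

theorem comp_eq_iff_diag (h0 : IsInitial (𝟙_ (Variety L E))) {X D : Variety L E}
    {w : X ⊗ X ⟶ D} {z : 𝟙_ (Variety L E) ⟶ D} :
    lift (𝟙 X) (𝟙 X) ≫ w = toUnit X ≫ z ↔ ∀ x, w (pair x x) = zero h0 D := by
  constructor
  · exact fun h x => (ConcreteCategory.congr_hom h x).trans (hom_unit_apply h0 z _)
  · exact fun h => ConcreteCategory.hom_ext _ _ fun x => (h x).trans (hom_unit_apply h0 z _).symm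

theorem diagCongruence_le_ker (h0 : IsInitial (𝟙_ (Variety L E))) {X D : Variety L E}
    {w : X ⊗ X ⟶ D} {z : 𝟙_ (Variety L E) ⟶ D}
    (h : lift (𝟙 X) (𝟙 X) ≫ w = toUnit X ≫ z) : diagCongruence X ≤ ker w := by
  have hw := (comp_eq_iff_diag h0).1 h
  exact sInf_le fun x y => (hw x).trans (hw y).symm

theorem isDiagonalPunctuation_quot (h0 : IsInitial (𝟙_ (Variety L E))) (X : Variety L E) :
    IsDiagonalPunctuation (quotMk (X ⊗ X) (diagCongruence X)) (h0.to _) := by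
  have hπ := quotMk_surjective (X ⊗ X) (diagCongruence X)
  have factors (s : PushoutCocone (lift (𝟙 X) (𝟙 X)) (toUnit X)) :
      Function.FactorsThrough s.inl (quotMk (X ⊗ X) (diagCongruence X)) := fun _ _ h =>
    diagCongruence_le_ker h0 s.condition (quotMk_eq_iff.1 h)
  refine ⟨⟨(comp_eq_iff_diag h0).2 fun x => ?_⟩, ⟨PushoutCocone.IsColimit.mk _
    (fun s => descend _ hπ s.inl (factors s))
    (fun s => ConcreteCategory.hom_ext _ _ (descend_apply _ hπ _ (factors s)))
    (fun s => h0.hom_ext _ _) fun s m hm _ => ConcreteCategory.hom_ext _ _ fun q => ?_⟩⟩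
  · rw [← map_zero h0 (quotMk _ _), ← pair_zero, quotMk_eq_iff]
    exact diagCongruence_diag X _ _
  · obtain ⟨a, rfl⟩ := hπ q
    rw [descend_apply]
    exact ConcreteCategory.congr_hom hm a

section Punctuation

variable (h0) {X D : Variety L E} {w : X ⊗ X ⟶ D} {z : 𝟙_ (Variety L E) ⟶ D}
  (hD : IsDiagonalPunctuation w z)

include h0 hD

theorem punctuation_diag (x : X.carrier) : w (pair x x) = zero h0 D :=
  (comp_eq_iff_diag h0).1 hD.w x

theorem punctuation_diag_eq (x y : X.carrier) : w (pair x x) = w (pair y y) :=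
  (punctuation_diag h0 hD x).trans (punctuation_diag h0 hD y).symm

theorem punctuation_surjective : Function.Surjective w := by
  have h := isDiagonalPunctuation_quot h0 X
  have hw : quotMk (X ⊗ X) (diagCongruence X) ≫ (h.isoIsPushout _ _ hD).hom = w :=
    h.inl_isoIsPushout_hom _ _ hD
  rw [← hw]
  exact (ConcreteCategory.bijective_of_isIso (h.isoIsPushout _ _ hD).hom).surjective.comp
    (quotMk_surjective _ _)

theorem diagonalComparison_surjective (hp : IsDifferenceTerm p) :
    Function.Surjective (diagonalComparison h0 w) := by
  intro d
  obtain ⟨⟨a, b⟩, rfl⟩ := punctuation_surjective h0 hD d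
  exact ⟨op p ![b, a, zero h0 X],
    (hp.map_pair_eq w (punctuation_diag_eq h0 hD) (zero h0 X) b a).symm⟩

theorem exists_isSubtraction (hp : IsDifferenceTerm p) : ∃ s : D ⊗ D ⟶ D, IsSubtraction h0 s := by
  have hd := punctuation_diag h0 hD
  let e := diagonalComparison h0 w
  have he : Function.Surjective e := diagonalComparison_surjective h0 hD hp
  let q : X ⊗ X ⟶ D ⊗ D := lift (fst X X ≫ e) (snd X X ≫ e)
  have hq : Function.Surjective q := he.prodMap he
  let w' : X ⊗ X ⟶ D := lift (snd X X) (fst X X) ≫ w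
  have w'_eq (x : (X ⊗ X).carrier) : w' x = op p ![(q x).1, (q x).2, zero h0 D] := by
    rw [← hd (zero h0 X)]
    exact hp.map_pair_eq_op w (punctuation_diag_eq h0 hD) (zero h0 X) x.1 x.2
  have hw' : Function.FactorsThrough w' q := fun x y h => by rw [w'_eq, w'_eq, h]
  have key (x y : X.carrier) : descend q hq w' hw' (pair (e x) (e y)) = w (pair y x) :=
    descend_apply q hq w' hw' (pair x y)
  refine ⟨descend q hq w' hw', fun a => ?_, fun a => ?_⟩
  · obtain ⟨x, rfl⟩ := he a
    exact (key x x).trans (hd x)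
  · obtain ⟨x, rfl⟩ := he a
    rw [← map_zero h0 e]
    exact key x (zero h0 X)

theorem exists_desc {A : Variety L E} {s : A ⊗ A ⟶ A} (hs : IsSubtraction h0 s) (f : X ⟶ A) :
    ∃ k : D ⟶ A, ∀ x, k (diagonalComparison h0 w x) = f x := by
  let g : X ⊗ X ⟶ A := lift (snd X X ≫ f) (fst X X ≫ f) ≫ s
  have h : lift (𝟙 X) (𝟙 X) ≫ g = toUnit X ≫ h0.to A :=
    (comp_eq_iff_diag h0).2 fun x => hs.self (f x)
  refine ⟨hD.desc g (h0.to A) h, fun x => ?_⟩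
  calc hD.desc g (h0.to A) h (diagonalComparison h0 w x)
      = s (pair (f x) (f (zero h0 X))) :=
        ConcreteCategory.congr_hom (hD.inl_desc g (h0.to A) h) (pair (zero h0 X) x)
    _ = f x := by rw [map_zero h0, hs.right_zero]

theorem existsUnique_commGrpHom (hp : IsDifferenceTerm p) [GrpObj D] [IsCommMonObj D]
    (A : CommGrp (Variety L E)) (f : X ⟶ A.X) :
    ∃! k : CommGrp.mk D ⟶ A,
      diagonalComparison h0 w ≫ (CommGrp.forget (Variety L E)).map k = f := by
  obtain ⟨k, hk⟩ := exists_desc h0 hD (isSubtraction_grpSub h0 A.X) f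
  refine ⟨commGrpHom h0 hp k, ConcreteCategory.hom_ext _ _ hk, fun k' hk' => ?_⟩
  refine (CommGrp.forget (Variety L E)).map_injective (ConcreteCategory.hom_ext _ _ fun d => ?_)
  obtain ⟨x, rfl⟩ := diagonalComparison_surjective h0 hD hp d
  exact (ConcreteCategory.congr_hom hk' x).trans (hk x).symm

end Punctuation

/-! ### The subvariety of internal abelian groups -/

/-- The identities satisfied by all the algebras of a class. -/
def identities (P : ObjectProperty (Variety L E)) : Set (L.Term ℕ × L.Term ℕ) :=
  {e | ∀ A : Variety L E, P A → ∀ x : ℕ → A.carrier, e.1.realize x = e.2.realize x}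

theorem op_eq_of_satisfies_identities {α : Type} [Countable α] {P : ObjectProperty (Variety L E)}
    {A : Variety L E} (hA : Satisfies (identities P) A.carrier) {m m' : (free L E α).carrier}
    (h : ∀ B : Variety L E, P B → ∀ x : α → B.carrier, op m x = op m' x) (x : α → A.carrier) :
    op m x = op m' x := by
  obtain ⟨s, rfl⟩ := freeMk_surjective m
  obtain ⟨t, rfl⟩ := freeMk_surjective m'
  obtain ⟨i, hi⟩ := exists_injective_nat α
  have mem : (s.relabel i, t.relabel i) ∈ identities P := fun B hB y => by
    rw [Term.realize_relabel, Term.realize_relabel]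
    exact h B hB (y ∘ i)
  let y : ℕ → A.carrier := Function.extend i x fun _ => s.realize x
  have hy : y ∘ i = x := Function.extend_comp hi _ _
  have key := hA _ mem y
  rwa [Term.realize_relabel, Term.realize_relabel, hy] at key

variable (L E) in
/-- The identities satisfied by all the internal groups of a variety. -/
def groupIdentities : Set (L.Term ℕ × L.Term ℕ) :=
  identities fun A : Variety L E => Nonempty (GrpObj A)

theorem op_right_of_satisfies (h0 : IsInitial (𝟙_ (Variety L E))) (hp : IsDifferenceTerm p)
    {A : Variety L E} (hA : Satisfies (groupIdentities L E) A.carrier) (a b : A.carrier) :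
    op p ![a, b, b] = a := by
  let m : (free L E (Fin 2)).carrier := op p ![gen 0, gen 1, gen 1]
  have op_m {B : Variety L E} (x : Fin 2 → B.carrier) : op m x = op p ![x 0, x 1, x 1] :=
    map_op₃ (freeLift x) p ..
  have key := op_eq_of_satisfies_identities hA (m := m) (m' := gen 0)
    (fun B ⟨_⟩ x => (op_m x).trans ((isSubtraction_grpSub h0 B).op_right hp _ _)) ![a, b]
  exact (op_m _).symm.trans key

theorem op_funMap_eq_of_satisfies (h0 : IsInitial (𝟙_ (Variety L E))) (hp : IsDifferenceTerm p)
    {A : Variety L E} (hA : Satisfies (groupIdentities L E) A.carrier) {n : ℕ}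
    (o : L.Functions n) (x y z : Fin n → A.carrier) :
    op p ![funMap o x, funMap o y, funMap o z] = funMap o fun i => op p ![x i, y i, z i] := by
  let g (k : Fin 3) (i : Fin n) : (free L E (Fin 3 × Fin n)).carrier := gen (k, i)
  let m : (free L E (Fin 3 × Fin n)).carrier :=
    op p ![funMap o (g 0), funMap o (g 1), funMap o (g 2)]
  let m' : (free L E (Fin 3 × Fin n)).carrier := funMap o fun i => op p ![g 0 i, g 1 i, g 2 i]
  have op_m {B : Variety L E} (v : Fin 3 × Fin n → B.carrier) : op m v =
      op p ![funMap o fun i => v (0, i), funMap o fun i => v (1, i),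
        funMap o fun i => v (2, i)] := by
    refine (map_op₃ (freeLift v) p ..).trans ?_
    simp only [map_funMap]
    rfl
  have op_m' {B : Variety L E} (v : Fin 3 × Fin n → B.carrier) :
      op m' v = funMap o fun i => op p ![v (0, i), v (1, i), v (2, i)] :=
    (op_funMap o _ v).trans (congrArg _ (funext fun i => map_op₃ (freeLift v) p ..))
  have key := op_eq_of_satisfies_identities hA (m := m) (m' := m')
    (fun B ⟨_⟩ v => (op_m v).trans
      (((isSubtraction_grpSub h0 B).op_funMap_eq hp o _ _ _).trans (op_m' v).symm))
    fun k => ![x, y, z] k.1 k.2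
  exact (op_m _).symm.trans (key.trans (op_m' _))

theorem exists_isSubtraction_of_satisfies (h0 : IsInitial (𝟙_ (Variety L E)))
    (hp : IsDifferenceTerm p) {A : Variety L E}
    (hA : Satisfies (groupIdentities L E) A.carrier) :
    ∃ s : A ⊗ A ⟶ A, IsSubtraction h0 s := by
  let s : A ⊗ A ⟶ A := homMk (fun x => op p ![x.1, x.2, zero h0 A]) fun {n} o x => by
    have zero_eq : zero h0 A = funMap o fun _ : Fin n => zero h0 A :=
      map_funMap (h0.to A) o fun _ => PUnit.unit
    conv_lhs => rw [zero_eq]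
    exact op_funMap_eq_of_satisfies h0 hp hA o (fun i => (x i).1) (fun i => (x i).2) _
  exact ⟨s, fun a => hp.left A a _, fun a => op_right_of_satisfies h0 hp hA a _⟩

theorem essImage_of_isSubtraction (hp : IsDifferenceTerm p) {A : Variety L E} {s : A ⊗ A ⟶ A}
    (hs : IsSubtraction h0 s) : (CommGrp.forget (Variety L E)).essImage A :=
  let _ := hs.grpObj hp
  have := hs.isCommMonObj hp
  (CommGrp.forget (Variety L E)).obj_mem_essImage (CommGrp.mk A)

theorem essImage_iff_satisfies (h0 : IsInitial (𝟙_ (Variety L E))) (hp : IsDifferenceTerm p)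
    (A : Variety L E) :
    (CommGrp.forget (Variety L E)).essImage A ↔ Satisfies (groupIdentities L E) A.carrier := by
  constructor
  · rintro ⟨G, ⟨i⟩⟩
    exact satisfies_of_surjective (A := G.X) i.hom
      (ConcreteCategory.bijective_of_isIso i.hom).surjective fun e he x => he G.X ⟨inferInstance⟩ x
  · intro h
    obtain ⟨s, hs⟩ := exists_isSubtraction_of_satisfies h0 hp h
    exact essImage_of_isSubtraction hp hs

theorem hasInitial_structuredArrow_forget (h0 : IsInitial (𝟙_ (Variety L E)))
    (hp : IsDifferenceTerm p) (X : Variety L E) :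
    HasInitial (StructuredArrow X (CommGrp.forget (Variety L E))) := by
  have hD := isDiagonalPunctuation_quot h0 X
  obtain ⟨s, hs⟩ := exists_isSubtraction h0 hD hp
  let _ := hs.grpObj hp
  have := hs.isCommMonObj hp
  choose k hk k_unique using existsUnique_commGrpHom h0 hD hp
  let e : StructuredArrow X (CommGrp.forget (Variety L E)) :=
    StructuredArrow.mk (S := X) (T := CommGrp.forget (Variety L E))
      (Y := CommGrp.mk (quot (X ⊗ X) (diagCongruence X)))
      (diagonalComparison h0 (quotMk (X ⊗ X) (diagCongruence X)))
  have he : IsInitial e := IsInitial.ofUniqueHom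
    (fun Y => StructuredArrow.homMk (k Y.right Y.hom) (hk Y.right Y.hom)) fun Y m =>
      StructuredArrow.hom_ext _ _ (k_unique Y.right Y.hom m.right (StructuredArrow.w m))
  exact he.hasInitial

theorem isBirkhoffSubcategory_commGrp (h0 : IsInitial (𝟙_ (Variety L E)))
    (hp : IsDifferenceTerm p) : IsBirkhoffSubcategory (CommGrp.forget (Variety L E)) where
  full := ⟨fun f => ⟨commGrpHom h0 hp f, rfl⟩⟩
  faithful := inferInstance
  reflective :=
    have := hasInitial_structuredArrow_forget h0 hp
    isRightAdjointOfStructuredArrowInitials _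
  of_mono f _ h := by
    rw [essImage_iff_satisfies h0 hp] at h ⊢
    exact satisfies_of_injective f (injective_of_mono f) h
  of_regularEpi f _ h := by
    rw [essImage_iff_satisfies h0 hp] at h ⊢
    exact satisfies_of_surjective f (surjective_of_isRegularEpi f) h

end Variety

end UnivAlg

theorem mainTheorem6 (L : FirstOrder.Language.{u, v}) [L.IsAlgebraic]
    (E : Set (L.Term ℕ × L.Term ℕ))
    (hpointed : IsInitial (𝟙_ (UnivAlg.Variety L E)))
    (hmodular : UnivAlg.CongruenceModular L E) :
    (∀ X : UnivAlg.Variety L E,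
      (∃ (D : UnivAlg.Variety L E) (ω : X ⊗ X ⟶ D) (z : 𝟙_ (UnivAlg.Variety L E) ⟶ D),
        IsDiagonalPunctuation ω z) ∧
      ∀ (D : UnivAlg.Variety L E) (ω : X ⊗ X ⟶ D) (z : 𝟙_ (UnivAlg.Variety L E) ⟶ D),
        IsDiagonalPunctuation ω z →
        (∃ (G : GrpObj D) (_ : IsCommMonObj D),
          η[D] = z ∧
          (∀ G' : GrpObj D, G'.one = z → G' = G) ∧
          ∀ (A : CommGrp (UnivAlg.Variety L E)) (f : X ⟶ A.X),
            ∃! φ : CommGrp.mk D ⟶ A,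
              diagonalComparison hpointed ω ≫ (CommGrp.forget _).map φ = f) ∧
        Function.Surjective (diagonalComparison hpointed ω)) ∧
    IsBirkhoffSubcategory (CommGrp.forget (UnivAlg.Variety L E)) ∧
    ∃ E' : Set (L.Term ℕ × L.Term ℕ), ∀ A : UnivAlg.Variety L E,
      (CommGrp.forget (UnivAlg.Variety L E)).essImage A ↔ UnivAlg.Satisfies E' A.carrier := by
  obtain ⟨p, hp⟩ := UnivAlg.Variety.exists_isDifferenceTerm hmodular
  refine ⟨fun X => ⟨⟨_, _, _, UnivAlg.Variety.isDiagonalPunctuation_quot hpointed X⟩,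
      fun D ω z hD => ⟨?_, UnivAlg.Variety.diagonalComparison_surjective hpointed hD hp⟩⟩,
    UnivAlg.Variety.isBirkhoffSubcategory_commGrp hpointed hp, UnivAlg.Variety.groupIdentities L E,
    UnivAlg.Variety.essImage_iff_satisfies hpointed hp⟩
  obtain ⟨s, hs⟩ := UnivAlg.Variety.exists_isSubtraction hpointed hD hp
  let G := hs.grpObj hp
  have hG := hs.isCommMonObj hp
  exact ⟨G, hG, hpointed.hom_ext _ _,
    fun G' _ => UnivAlg.Variety.grpObj_unique hpointed hp G' G,
    UnivAlg.Variety.existsUnique_commGrpHom hpointed hD hp⟩
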